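/- Let $d\ge 2$ be an integer and $c\in\mathbb{C}$, put $f(x)=x^d+c$, and write $f^k$ for the $k$-th iterate of $f$ under composition ($f^0(x)=x$). Suppose that $f$ is post-critically finite of exact type $(m,n)$ with $m\ne 0$; that is, $m\ge 1$, $n$ is the least positive integer with $f^m(0)=f^{m+n}(0)$, and $f^k(0)\ne f^{k+n}(0)$ for all integers $0\le k<m$. (Then $c$ is algebraic.) Let $K=\mathbb{Q}(c)$, let $N\ge 1$ be any integer, and let $K_N$ be the splitting field of $f^N(x)$ over $K$. If a nonzero prime ideal $\mathfrak p$ of the ring of integers $\mathcal{O}_K$ ramifies in $K_N$, then $\mathfrak p$ divides the ideal $d\,\mathcal{O}_K$. -/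

import Mathlib

open Polynomial NumberField IntermediateField

/-- The unicritical polynomial `x ^ d + c`. -/
noncomputable def unicritical {R : Type*} [CommRing R] (d : ℕ) (c : R) : R[X] :=
  X ^ d + C c

/-- The `N`-th iterate of a polynomial under composition; the `0`-th iterate is `x`. -/
noncomputable def polyIterate {R : Type*} [CommRing R] (f : R[X]) (N : ℕ) : R[X] :=
  f.comp^[N] X

/-- `f` has exact type `(m, n)` (for the critical point `0`): `n` is the least positive integer with
`f^m(0) = f^(m+n)(0)`, and `f^k(0) ≠ f^(k+n)(0)` for all `0 ≤ k < m`. -/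
def HasExactType {R : Type*} [CommRing R] (f : R[X]) (m n : ℕ) : Prop :=
  IsLeast {l : ℕ | 0 < l ∧ (polyIterate f m).eval 0 = (polyIterate f (m + l)).eval 0} n ∧
    ∀ k < m, (polyIterate f k).eval 0 ≠ (polyIterate f (k + n)).eval 0

/-- An ideal `p` of the ring of integers of `K` (meant to be a nonzero prime) ramifies in the
extension `L` of `K`: some prime `P` of `L` above `p` has ramification index `e(P / p) > 1`. -/
def RamifiesIn {K : Type*} [Field K] (p : Ideal (𝓞 K)) (L : Type*) [Field L] [Algebra K L] : Prop :=
  ∃ P : Ideal (𝓞 L), P.IsPrime ∧ P.LiesOver p ∧ 1 < P.ramificationIdx (𝓞 K)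

/-! Let `P` be a prime of `L` not containing `d`. If an inertia element moves a root of `f^N`, two
distinct roots agree modulo `P`, which forces `0` to be periodic modulo `P`
(`exists_iterate_mem_of_sub_mem`). `iterate_zero_notMem` excludes this when `0` is strictly
preperiodic. So inertia is trivial and `P` is unramified. -/

/-- The `N`-th iterate of `x ^ d + c`, evaluated through a ring homomorphism, is the `N`-th iterate
of the function `y ↦ y ^ d + c`. -/
theorem eval₂_polyIterate_unicritical {R S : Type*} [CommRing R] [CommRing S] (φ : R →+* S)
    (d : ℕ) (c : R) (N : ℕ) (x : S) :
    (polyIterate (unicritical d c) N).eval₂ φ x = (fun y : S ↦ y ^ d + φ c)^[N] x := by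
  induction N with
  | zero => simp [polyIterate]
  | succ N ih =>
    rw [polyIterate] at ih ⊢
    rw [Function.iterate_succ_apply', Function.iterate_succ_apply', Polynomial.eval₂_comp, ih]
    simp [unicritical]

theorem eval_polyIterate_unicritical {R : Type*} [CommRing R] (d : ℕ) (c : R) (N : ℕ) (x : R) :
    (polyIterate (unicritical d c) N).eval x = (fun y : R ↦ y ^ d + c)^[N] x :=
  eval₂_polyIterate_unicritical (RingHom.id R) d c N x

theorem map_iterate_pow_add {R S : Type*} [CommRing R] [CommRing S] (φ : R →+* S)
    (d : ℕ) (c : R) (N : ℕ) (x : R) :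
    φ ((fun y : R ↦ y ^ d + c)^[N] x) = (fun y : S ↦ y ^ d + φ c)^[N] (φ x) :=
  (Function.Semiconj.iterate_right (f := φ) (fun y ↦ by simp) N) x

theorem sub_dvd_iterate_pow_add_sub {R : Type*} [CommRing R] (d : ℕ) (c : R) (N : ℕ) (x y : R) :
    x - y ∣ (fun z : R ↦ z ^ d + c)^[N] x - (fun z : R ↦ z ^ d + c)^[N] y := by
  rw [← eval_polyIterate_unicritical, ← eval_polyIterate_unicritical]
  exact sub_dvd_eval_sub x y _

/-- Distinct `d`-th roots of the same element which agree modulo a prime not containing `d`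
lie in that prime. -/
theorem Ideal.IsPrime.mem_of_pow_eq_pow {R : Type*} [CommRing R] [IsDomain R] {P : Ideal R}
    (hP : P.IsPrime) {d : ℕ} (hd : (d : R) ∉ P) {a b : R} (hab : a ^ d = b ^ d) (hne : a ≠ b)
    (hmem : a - b ∈ P) : a ∈ P := by
  -- This cofactor of `a - b` in `a ^ d - b ^ d` reduces to `d * a ^ (d - 1)` modulo `P`.
  have h0 : ∑ i ∈ Finset.range d, a ^ i * b ^ (d - 1 - i) = 0 := by
    have := (Commute.all a b).geom_sum₂_mul d
    rw [hab, sub_self] at this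
    exact (mul_eq_zero.mp this).resolve_right (sub_ne_zero.mpr hne)
  have hq : Ideal.Quotient.mk P b = Ideal.Quotient.mk P a :=
    (Ideal.Quotient.eq.mpr hmem).symm
  have h1 := congrArg (Ideal.Quotient.mk P) h0
  simp only [map_sum, map_mul, map_pow, hq, map_zero] at h1
  rw [geom_sum₂_self, ← map_natCast (Ideal.Quotient.mk P),
    ← map_pow, ← map_mul, Ideal.Quotient.eq_zero_iff_mem] at h1
  exact hP.mem_of_pow_mem _ ((hP.mem_or_mem h1).resolve_left hd)

/-- If two distinct points agree modulo a prime `P` not containing `d` and have the same `N`-th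
iterate, then their orbit meets the critical point modulo `P` before time `N`. -/
theorem exists_iterate_mem_of_sub_mem {R : Type*} [CommRing R] [IsDomain R] {P : Ideal R}
    (hP : P.IsPrime) {d : ℕ} (hd : (d : R) ∉ P) (c : R) {x y : R} (hne : x ≠ y)
    (hmem : x - y ∈ P) (N : ℕ)
    (h : (fun z : R ↦ z ^ d + c)^[N] x = (fun z : R ↦ z ^ d + c)^[N] y) :
    ∃ k < N, (fun z : R ↦ z ^ d + c)^[k] x ∈ P := by
  induction N with
  | zero => exact absurd h hne
  | succ N ih =>
    by_cases hN : (fun z : R ↦ z ^ d + c)^[N] x = (fun z : R ↦ z ^ d + c)^[N] y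
    · obtain ⟨k, hk, hk'⟩ := ih hN
      exact ⟨k, by omega, hk'⟩
    · refine ⟨N, by omega, hP.mem_of_pow_eq_pow hd ?_ hN ?_⟩
      · simpa only [Function.iterate_succ_apply', add_left_inj] using h
      · exact P.mem_of_dvd (sub_dvd_iterate_pow_add_sub d c N x y) hmem

/-- Since `0` is critical, `F b - F 0 = b ^ d`: perturbing `0` by a multiple of `a = F^[j] 0`
changes `F^[j]` only by a multiple of `a ^ 2`. -/
theorem sq_dvd_iterate_mul_sub {R : Type*} [CommRing R] {d : ℕ} (hd : 2 ≤ d) (c : R) {j : ℕ}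
    (hj : j ≠ 0) (k : ℕ) :
    ((fun z : R ↦ z ^ d + c)^[j] 0) ^ 2 ∣
      (fun z : R ↦ z ^ d + c)^[j * (k + 1)] 0 - (fun z : R ↦ z ^ d + c)^[j] 0 := by
  induction k with
  | zero => simp
  | succ k ih =>
    set F := fun z : R ↦ z ^ d + c with hF
    set b := F^[j * (k + 1)] 0 with hb
    set a := F^[j] 0 with ha
    have hab : a ∣ b := by
      have : a ∣ b - a := (dvd_pow_self a two_ne_zero).trans ih
      simpa using this.add (dvd_refl a)
    have hpow : b ^ d ∣ F^[j] b - a := by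
      obtain ⟨i, rfl⟩ := Nat.exists_eq_succ_of_ne_zero hj
      have := sub_dvd_iterate_pow_add_sub d c i (F b) (F 0)
      rw [← hF, ← Function.iterate_succ_apply F, ← Function.iterate_succ_apply F, ← ha] at this
      have hsub : F b - F 0 = b ^ d := by simp [hF, zero_pow (by omega : d ≠ 0)]
      rwa [hsub] at this
    rw [show j * (k + 1 + 1) = j + j * (k + 1) by ring, Function.iterate_add_apply]
    exact ((pow_dvd_pow a hd).trans (pow_dvd_pow_of_dvd hab d)).trans hpow

/-- If the critical point of `x ^ d + c` is strictly preperiodic, with preperiod exactly `m ≥ 1`,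
then it is not periodic modulo any prime not containing `d`. -/
theorem iterate_zero_notMem {R : Type*} [CommRing R] [IsDomain R] {P : Ideal R}
    (hP : P.IsPrime) {d : ℕ} (hd2 : 2 ≤ d) (hd : (d : R) ∉ P) (c : R) {m n : ℕ}
    (heq : (fun z : R ↦ z ^ d + c)^[m + 1] 0 = (fun z : R ↦ z ^ d + c)^[m + 1 + n] 0)
    (hne : (fun z : R ↦ z ^ d + c)^[m] 0 ≠ (fun z : R ↦ z ^ d + c)^[m + n] 0)
    {i : ℕ} (hi : i ≠ 0) : (fun z : R ↦ z ^ d + c)^[i] 0 ∉ P := by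
  intro hmem
  set F := fun z : R ↦ z ^ d + c with hF
  set G := fun z : R ⧸ P ↦ z ^ d + Ideal.Quotient.mk P c with hG
  have hFG (k : ℕ) : Ideal.Quotient.mk P (F^[k] 0) = G^[k] 0 := by
    simpa using map_iterate_pow_add (Ideal.Quotient.mk P) d c k 0
  have hmemG (k : ℕ) : F^[k] 0 ∈ P ↔ Function.IsPeriodicPt G k 0 := by
    rw [← Ideal.Quotient.eq_zero_iff_mem, hFG]; rfl
  have hper : Function.IsPeriodicPt G i 0 := (hmemG i).mp hmem
  set j := Function.minimalPeriod G 0 with hj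
  have hj0 : j ≠ 0 := (hper.minimalPeriod_pos (Nat.pos_of_ne_zero hi)).ne'
  -- Iterating `heq` up to time `i * (m + 1)`, a multiple of the period `i`, returns the left side
  -- to `0`.
  have hpern : Function.IsPeriodicPt G n 0 := by
    have h1 : G^[m + 1] 0 = G^[m + 1 + n] 0 := by rw [← hFG, ← hFG, heq]
    have hle : m + 1 ≤ i * (m + 1) := Nat.le_mul_of_pos_left _ (Nat.pos_of_ne_zero hi)
    have h2 := congrArg G^[i * (m + 1) - (m + 1)] h1
    rw [← Function.iterate_add_apply, ← Function.iterate_add_apply, ← add_assoc _ (m + 1) n,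
      Nat.sub_add_cancel hle, add_comm _ n, Function.iterate_add_apply,
      (hper.mul_const (m + 1)).eq] at h2
    exact h2.symm
  have hpow : (F^[m] 0) ^ d = (F^[m + n] 0) ^ d := by
    rw [add_right_comm, Function.iterate_succ_apply', Function.iterate_succ_apply'] at heq
    simpa [hF] using heq
  have hsub : F^[m] 0 - F^[m + n] 0 ∈ P := by
    rw [← Ideal.Quotient.eq, hFG, hFG, Function.iterate_add_apply, hpern.eq]
  have hperm : Function.IsPeriodicPt G m 0 :=
    (hmemG m).mp (hP.mem_of_pow_eq_pow hd hpow hne hsub)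
  have hm : m ≠ 0 := by
    rintro rfl
    apply hne
    have hd0 : d ≠ 0 := by omega
    rw [Function.iterate_zero_apply, zero_pow hd0] at hpow
    rw [Function.iterate_zero_apply, eq_zero_of_pow_eq_zero hpow.symm]
  obtain ⟨s, hs⟩ := hperm.minimalPeriod_dvd
  obtain ⟨t, ht⟩ := hpern.minimalPeriod_dvd
  rw [← hj] at hs ht
  obtain ⟨s, rfl⟩ : ∃ s', s = s' + 1 := Nat.exists_eq_succ_of_ne_zero (by rintro rfl; omega)
  have hst : m + n = j * (s + t + 1) := by rw [hs, ht]; ring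
  obtain ⟨u, hu⟩ := sq_dvd_iterate_mul_sub hd2 c hj0 s
  obtain ⟨v, hv⟩ := sq_dvd_iterate_mul_sub hd2 c hj0 (s + t)
  rw [← hF, ← hs] at hu
  rw [← hF, ← hst] at hv
  set a := F^[j] 0 with ha
  have haP : a ∈ P := (hmemG j).mpr (Function.isPeriodicPt_minimalPeriod G 0)
  have hu' : F^[m] 0 = a * (1 + a * u) := by linear_combination hu
  have hv' : F^[m + n] 0 = a * (1 + a * v) := by linear_combination hv
  have ha0 : a ≠ 0 := by
    rintro h0
    apply hne
    rw [hu', hv', h0, zero_mul, zero_mul]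
  rw [hu', hv'] at hpow hne
  rw [mul_pow, mul_pow] at hpow
  -- After cancelling `a ^ d`, the distinct cofactors have equal `d`-th powers and are both `1`
  -- modulo `P`, which is absurd.
  have hmem1 : 1 + a * u ∈ P :=
    hP.mem_of_pow_eq_pow hd (mul_left_cancel₀ (pow_ne_zero d ha0) hpow) (fun h ↦ hne (by rw [h]))
      (by
        rw [show 1 + a * u - (1 + a * v) = a * (u - v) by ring]
        exact P.mul_mem_right _ haP)
  exact hP.ne_top ((Ideal.eq_top_iff_one P).mpr
    ((P.add_mem_iff_left (P.mul_mem_right u haP)).mp hmem1))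

/-- The critical orbit of `x ^ d + t`, as polynomials in the parameter `t`. -/
theorem monic_natDegree_iterate_pow_add_X {d : ℕ} (hd : 2 ≤ d) (k : ℕ) :
    ((fun g : ℤ[X] ↦ g ^ d + X)^[k + 1] 0).Monic ∧
      ((fun g : ℤ[X] ↦ g ^ d + X)^[k + 1] 0).natDegree = d ^ k := by
  induction k with
  | zero => simp [zero_pow (by omega : d ≠ 0), monic_X]
  | succ k ih =>
    rw [Function.iterate_succ_apply']
    obtain ⟨hmonic, hdeg⟩ := ih
    set g := (fun g : ℤ[X] ↦ g ^ d + X)^[k + 1] 0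
    have hdeg' : (g ^ d).natDegree = d ^ (k + 1) := by
      rw [hmonic.natDegree_pow, hdeg, pow_succ']
    have hlt : (X : ℤ[X]).natDegree < (g ^ d).natDegree := by
      rw [natDegree_X, hdeg']
      exact Nat.one_lt_pow (by omega) (by omega)
    exact ⟨(hmonic.pow d).add_of_left (degree_lt_degree hlt),
      (natDegree_add_eq_left_of_natDegree_lt hlt).trans hdeg'⟩

/-- A parameter for which the critical point is preperiodic is an algebraic integer. -/
theorem isIntegral_of_iterate_eq {R : Type*} [CommRing R] {d : ℕ} (hd : 2 ≤ d) {c : R} {m n : ℕ}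
    (hn : n ≠ 0)
    (heq : (fun z : R ↦ z ^ d + c)^[m + 1] 0 = (fun z : R ↦ z ^ d + c)^[m + 1 + n] 0) :
    IsIntegral ℤ c := by
  obtain ⟨hm1, hd1⟩ := monic_natDegree_iterate_pow_add_X hd m
  obtain ⟨hm2, hd2⟩ := monic_natDegree_iterate_pow_add_X hd (m + n)
  rw [add_right_comm] at hm2 hd2
  -- The difference of the two orbit polynomials is monic, as `d ^ m < d ^ (m + n)`, and vanishes at
  -- `c`.
  refine ⟨_, hm2.sub_of_left (q := (fun g : ℤ[X] ↦ g ^ d + X)^[m + 1] 0)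
    (degree_lt_degree ?_), ?_⟩
  · rw [hd1, hd2]
    exact Nat.pow_lt_pow_right (by omega) (by omega)
  · have h (k : ℕ) : eval₂ (algebraMap ℤ R) c ((fun g : ℤ[X] ↦ g ^ d + X)^[k] 0) =
        (fun z : R ↦ z ^ d + c)^[k] 0 := by
      simpa using map_iterate_pow_add (eval₂RingHom (algebraMap ℤ R) c) d X k 0
    rw [eval₂_sub, h, h, heq, sub_self]

theorem isIntegral_of_iterate {R : Type*} [CommRing R] {d : ℕ} (hd : d ≠ 0) {c x : R}
    (hc : IsIntegral ℤ c) (N : ℕ) (h : IsIntegral ℤ ((fun z : R ↦ z ^ d + c)^[N] x)) :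
    IsIntegral ℤ x := by
  induction N generalizing x with
  | zero => exact h
  | succ N ih =>
    have := (ih (x := x ^ d + c) h).sub hc
    rw [add_sub_cancel_right] at this
    exact this.of_pow (Nat.pos_of_ne_zero hd)

/-- In a Galois extension of number fields, a prime with trivial inertia group is unramified. -/
theorem ramificationIdx_eq_one_of_inertia_eq_bot {K L : Type*} [Field K] [Field L]
    [NumberField K] [NumberField L] [Algebra K L] [IsGalois K L] (p : Ideal (𝓞 K)) [p.IsPrime]
    (hp0 : p ≠ ⊥) (P : Ideal (𝓞 L)) [P.IsPrime] [P.LiesOver p]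
    (h : P.inertia Gal(L/K) = ⊥) : P.ramificationIdx (𝓞 K) = 1 := by
  have : p.IsMaximal := Ideal.IsPrime.isMaximal ‹_› hp0
  have : Finite (𝓞 K ⧸ p) := Ideal.finiteQuotientOfFreeOfNeBot p hp0
  have : Finite p.ResidueField :=
    Finite.of_surjective _ (Ideal.bijective_algebraMap_quotient_residueField p).surjective
  rw [← Ideal.ramificationIdxIn_eq_ramificationIdx p P Gal(L/K),
    ← Ideal.card_inertia_eq_ramificationIdxIn (G := Gal(L/K)) p P, h]
  simp

theorem inertia_eq_bot_of_natCast_notMem {K L : Type*} [Field K] [Field L] [Algebra K L]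
    {d m n N : ℕ} (hd2 : 2 ≤ d) {c : K}
    (hn : n ≠ 0)
    (heq : (fun z : K ↦ z ^ d + c)^[m + 1] 0 = (fun z : K ↦ z ^ d + c)^[m + 1 + n] 0)
    (hne : (fun z : K ↦ z ^ d + c)^[m] 0 ≠ (fun z : K ↦ z ^ d + c)^[m + n] 0)
    [IsSplittingField K L (polyIterate (unicritical d c) N)]
    {P : Ideal (𝓞 L)} (hP : P.IsPrime) (hd : (d : 𝓞 L) ∉ P) :
    P.inertia Gal(L/K) = ⊥ := by
  have hcK : IsIntegral ℤ c := isIntegral_of_iterate_eq hd2 hn heq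
  have hcL : IsIntegral ℤ (algebraMap K L c) := hcK.map (Algebra.ofId K L).toIntAlgHom
  obtain ⟨c', hc'⟩ : ∃ c' : 𝓞 L, algebraMap (𝓞 L) L c' = algebraMap K L c := ⟨⟨_, hcL⟩, rfl⟩
  set F := fun z : 𝓞 L ↦ z ^ d + c' with hF
  have hKL (k : ℕ) : algebraMap (𝓞 L) L (F^[k] 0) =
      algebraMap K L ((fun z : K ↦ z ^ d + c)^[k] 0) := by
    rw [map_iterate_pow_add, map_iterate_pow_add, hc', map_zero, map_zero]
  have heq' : F^[m + 1] 0 = F^[m + 1 + n] 0 :=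
    RingOfIntegers.coe_injective (by rw [hKL, hKL, heq])
  have hne' : F^[m] 0 ≠ F^[m + n] 0 := fun h ↦
    hne ((algebraMap K L).injective (by rw [← hKL, ← hKL, h]))
  rw [eq_bot_iff]
  intro σ hσ
  rw [Subgroup.mem_bot]
  suffices (σ : L →ₐ[K] L) = AlgHom.id K L from AlgEquiv.ext fun x ↦ DFunLike.congr_fun this x
  refine AlgHom.ext_of_adjoin_eq_top
    (IsSplittingField.adjoin_rootSet L (polyIterate (unicritical d c) N)) fun α hα ↦ ?_
  have hα0 : (fun z : L ↦ z ^ d + algebraMap K L c)^[N] α = 0 := by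
    rw [← eval₂_polyIterate_unicritical]
    exact aeval_eq_zero_of_mem_rootSet hα
  have hαint : IsIntegral ℤ α :=
    isIntegral_of_iterate (d := d) (by omega) hcL N (by rw [hα0]; exact isIntegral_zero)
  obtain ⟨x, hx⟩ : ∃ x : 𝓞 L, algebraMap (𝓞 L) L x = α := ⟨⟨_, hαint⟩, rfl⟩
  have hx0 : F^[N] x = 0 := RingOfIntegers.coe_injective (by
    rw [map_iterate_pow_add, hc', hx, hα0, map_zero])
  have hσx : algebraMap (𝓞 L) L (σ • x) = σ α := by rw [← hx]; rfl
  have hσx0 : F^[N] (σ • x) = 0 := RingOfIntegers.coe_injective (by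
    have := map_iterate_pow_add (σ : L →+* L) d (algebraMap K L c) N α
    rw [map_iterate_pow_add, hc', hσx, map_zero]
    simpa [hα0] using this.symm)
  by_contra hne2
  have hxne : σ • x ≠ x := fun h ↦ hne2 (by
    change σ α = α
    rw [← hσx, h, hx])
  obtain ⟨k, hk, hkP⟩ := exists_iterate_mem_of_sub_mem hP hd c' hxne (hσ x) N
    (hσx0.trans hx0.symm)
  refine iterate_zero_notMem hP hd2 hd c' heq' hne' (i := N - k) (by omega) ?_
  -- The orbit of the root reaches `0` at time `N`, so `F^[k] (σ • x)` divides `F^[N - k] 0`.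
  have hdvd := sub_dvd_iterate_pow_add_sub d c' (N - k) (F^[k] (σ • x)) 0
  rw [← hF, ← Function.iterate_add_apply, Nat.sub_add_cancel hk.le, hσx0, sub_zero, zero_sub,
    dvd_neg] at hdvd
  exact P.mem_of_dvd hdvd hkP

theorem corollary1p5 (d m n : ℕ) (c : ℂ) (hd : 2 ≤ d) (hm : m ≠ 0)
    (htype : HasExactType (unicritical d c) m n)
    (N : ℕ) (hN : 1 ≤ N)
    (L : Type*) [Field L] [Algebra ℚ⟮c⟯ L]
    [IsSplittingField ℚ⟮c⟯ L (polyIterate (unicritical d (AdjoinSimple.gen ℚ c)) N)]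
    (p : Ideal (𝓞 ℚ⟮c⟯)) (hp : p.IsPrime) (hp0 : p ≠ ⊥)
    (hram : RamifiesIn p L) :
    p ∣ Ideal.span {(d : 𝓞 ℚ⟮c⟯)} := by
  obtain ⟨⟨⟨hn, heq⟩, -⟩, hne⟩ := htype
  -- From here the preperiod is `m + 1`; of the inequalities, only the one at index `m` is needed.
  obtain ⟨m, rfl⟩ := Nat.exists_eq_succ_of_ne_zero hm
  replace hne := hne m (Nat.lt_succ_self m)
  simp only [eval_polyIterate_unicritical] at heq hne
  have hcint : IsIntegral ℤ c := isIntegral_of_iterate_eq hd hn.ne' heq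
  have : FiniteDimensional ℚ ℚ⟮c⟯ := adjoin.finiteDimensional hcint.tower_top
  have : NumberField ℚ⟮c⟯ := {}
  have : FiniteDimensional ℚ⟮c⟯ L :=
    IsSplittingField.finiteDimensional L (polyIterate (unicritical d (AdjoinSimple.gen ℚ c)) N)
  have : CharZero L := charZero_of_injective_algebraMap (algebraMap ℚ⟮c⟯ L).injective
  have : NumberField L :=
    { to_finiteDimensional := FiniteDimensional.trans ℚ ℚ⟮c⟯ L }
  have : Normal ℚ⟮c⟯ L :=
    Normal.of_isSplittingField (polyIterate (unicritical d (AdjoinSimple.gen ℚ c)) N)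
  have : IsGalois ℚ⟮c⟯ L := {}
  have hKC (k : ℕ) : algebraMap ℚ⟮c⟯ ℂ ((fun z ↦ z ^ d + AdjoinSimple.gen ℚ c)^[k] 0) =
      (fun z : ℂ ↦ z ^ d + c)^[k] 0 := by
    rw [map_iterate_pow_add, AdjoinSimple.algebraMap_gen, map_zero]
  obtain ⟨P, hP, hPp, hram⟩ := hram
  rw [Ideal.dvd_span_singleton]
  by_contra hdp
  have hdP : (d : 𝓞 L) ∉ P := by
    rw [hPp.over, Ideal.mem_comap, map_natCast] at hdp
    exact hdp
  refine hram.ne' (ramificationIdx_eq_one_of_inertia_eq_bot p hp0 P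
    (inertia_eq_bot_of_natCast_notMem (N := N) hd hn.ne' (c := AdjoinSimple.gen ℚ c) (m := m)
      ?_ ?_ hP hdP))
  · exact (algebraMap ℚ⟮c⟯ ℂ).injective (by rw [hKC, hKC]; exact heq)
  · exact fun h ↦ hne (by rw [← hKC, ← hKC, h])
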